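/- Notation. Let $P$ be a finite partially ordered set. For $S\subseteq P$ let $\Delta S$ be the order complex of $S$ (the simplicial complex whose simplices are the nonempty chains contained in $S$), and also its geometric realization. For $m\in P$ put $P_{<m}=\{p\in P: p<m\}$ and $P_{>m}=\{p\in P: p>m\}$, and for $M\subseteq P$ put $P_{\notin M}=P\setminus M$. $X*Y$ denotes the join of topological spaces (so $X*\emptyset=X$ and $\emptyset*Y=Y$). Inside $\Delta P$, $\Delta P_{<m}*\Delta P_{>m}$ denotes the subcomplex of all simplices $a\cup b\neq\emptyset$ such that $a$ is empty or a simplex of $\Delta P_{<m}$, and $b$ is empty or a simplex of $\Delta P_{>m}$. $\Sigma X$ denotes the unreduced suspension, pointed at one of its two poles (so $\Sigma\emptyset=S^0$). A subspace $A\subseteq X$ is said to be contractible inside $X$ to the point $x\in X$ if the inclusion $A\hookrightarrow X$ is homotopic, as a map into $X$, to the constant map with value $x$. Theorem. Let $P$ be a finite partially ordered set. (a) Let $M\subseteq P$ be an antichain (then $\bigcup_{m\in M}\Delta P_{<m}*\Delta P_{>m}$ is a subcomplex of $\Delta P_{\notin M}$). Assume that $\bigcup_{m\in M}\Delta P_{<m}*\Delta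 P_{>m}$ is contractible inside $\Delta P_{\notin M}$ to a point $x\in\Delta P_{\notin M}$. Then there is a homotopy equivalence $$\Delta P\;\simeq\;\Delta P_{\notin M}\vee\bigvee_{m\in M}\Sigma\bigl(\Delta P_{<m}*\Delta P_{>m}\bigr),$$ where the wedge is formed at the point $x$ of $\Delta P_{\notin M}$ and at the poles of the suspensions. (b) Let $M\subseteq P$ be a set of (not necessarily all) maximal elements of $P$ (then $\bigcup_{m\in M}\Delta P_{<m}$ is a subcomplex of $\Delta P_{\notin M}$). Assume that $\bigcup_{m\in M}\Delta P_{<m}$ is contractible inside $\Delta P_{\notin M}$ to a point $x\in\Delta P_{\notin M}$. Then $$\Delta P\;\simeq\;\Delta P_{\notin M}\vee\bigvee_{m\in M}\Sigma\,\Delta P_{<m},$$ where the wedge is again formed at $x$ and at the poles of the suspensions. -/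

import Mathlib

open scoped unitInterval ContinuousMap

noncomputable section

namespace PosetTopology

universe u v w

/-! ### Simplicial complexes, order complexes, realizations -/

/-- The order complex `Δ S` of a subset `S` of a partially ordered set `P` (with the induced order),
as a simplicial complex with vertices in `P`: its faces are the nonempty finite chains contained
in `S`. -/
def orderComplex {P : Type u} [PartialOrder P] (S : Set P) : PreAbstractSimplicialComplex P where
  faces := {s | s.Nonempty ∧ (s : Set P) ⊆ S ∧ IsChain (· ≤ ·) (s : Set P)}
  isRelLowerSet_faces := fun _ hs => ⟨hs.1, fun _ hts ht =>
    ⟨ht, (Finset.coe_subset.2 hts).trans hs.2.1, hs.2.2.mono (Finset.coe_subset.2 hts)⟩⟩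

/-- The join of two simplicial complexes `K`, `L` (used for complexes without common vertices):
its faces are the nonempty unions `a ∪ b`, where `a` is empty or a face of `K` and
`b` is empty or a face of `L`. -/
def simplicialJoin {V : Type u} (K L : PreAbstractSimplicialComplex V) :
    PreAbstractSimplicialComplex V where
  faces := {s | s.Nonempty ∧ ∃ a b : Finset V, (a = ∅ ∨ a ∈ K.faces) ∧ (b = ∅ ∨ b ∈ L.faces) ∧
    (s : Set V) = (a : Set V) ∪ (b : Set V)}
  isRelLowerSet_faces := by
    classical
    rintro s ⟨hs, a, b, ha, hb, hab⟩
    refine ⟨hs, fun t hts ht => ⟨ht, a ∩ t, b ∩ t, ?_, ?_, ?_⟩⟩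
    · rcases (a ∩ t).eq_empty_or_nonempty with h | h
      · exact Or.inl h
      · rcases ha with rfl | ha
        · simp at h
        · exact Or.inr ((K.isRelLowerSet_faces ha).2 Finset.inter_subset_left h)
    · rcases (b ∩ t).eq_empty_or_nonempty with h | h
      · exact Or.inl h
      · rcases hb with rfl | hb
        · simp at h
        · exact Or.inr ((L.isRelLowerSet_faces hb).2 Finset.inter_subset_left h)
    · have h : (t : Set V) ⊆ (a : Set V) ∪ b := hab ▸ Finset.coe_subset.2 hts
      rw [Finset.coe_inter, Finset.coe_inter, ← Set.union_inter_distrib_right]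
      exact (Set.inter_eq_right.2 h).symm

/-- The geometric realization of a simplicial complex on a finite vertex set `V`, as a subspace of
`V → ℝ`: the points given by barycentric coordinates whose support lies in a face. -/
def realization {V : Type u} [Fintype V] (K : PreAbstractSimplicialComplex V) : Set (V → ℝ) :=
  {p | p ∈ stdSimplex ℝ V ∧ ∃ s ∈ K.faces, Function.support p ⊆ (s : Set V)}

theorem realization_mono {V : Type u} [Fintype V] {K L : PreAbstractSimplicialComplex V}
    (h : K ≤ L) : realization K ⊆ realization L :=
  fun _ hp => ⟨hp.1, hp.2.imp fun _ hs => ⟨h hs.1, hs.2⟩⟩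

/-! ### Join, unreduced suspension and wedge of topological spaces -/

/-- Gluing relation of the topological join: `(x, y, 0)` is identified with `x` and `(x, y, 1)`
with `y`. -/
inductive JoinRel (X : Type u) (Y : Type v) : (X ⊕ Y) ⊕ X × Y × I → (X ⊕ Y) ⊕ X × Y × I → Prop
  | left (x : X) (y : Y) : JoinRel X Y (Sum.inr (x, y, 0)) (Sum.inl (Sum.inl x))
  | right (x : X) (y : Y) : JoinRel X Y (Sum.inr (x, y, 1)) (Sum.inl (Sum.inr y))

/-- The join `X * Y` of topological spaces, including the conventions `X * ∅ = X`, `∅ * Y = Y`. -/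
def Join (X : Type u) (Y : Type v) : Type (max u v) := Quot (JoinRel X Y)

instance (X : Type u) (Y : Type v) [TopologicalSpace X] [TopologicalSpace Y] :
    TopologicalSpace (Join X Y) :=
  inferInstanceAs (TopologicalSpace (Quot (JoinRel X Y)))

/-- Gluing relation of the suspension: `X × {0}` is collapsed to the pole `false` and `X × {1}` to
the pole `true`. -/
inductive SuspensionRel (X : Type u) : Bool ⊕ X × I → Bool ⊕ X × I → Prop
  | bottom (x : X) : SuspensionRel X (Sum.inr (x, 0)) (Sum.inl false)
  | top (x : X) : SuspensionRel X (Sum.inr (x, 1)) (Sum.inl true)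

/-- The (unreduced) suspension `Σ X`. Its two poles are always present, so that `Σ ∅ = S⁰`. -/
def Suspension (X : Type u) : Type u := Quot (SuspensionRel X)

instance (X : Type u) [TopologicalSpace X] : TopologicalSpace (Suspension X) :=
  inferInstanceAs (TopologicalSpace (Quot (SuspensionRel X)))

/-- A pole of the suspension, used as its base point. -/
def Suspension.pole (X : Type u) : Suspension X := Quot.mk _ (Sum.inl false)

/-- Gluing relation of the wedge of a pointed space `(X, x)` with pointed spaces `(Y i, y i)`: all
base points are identified. -/
inductive WedgeRel {X : Type u} {ι : Type v} {Y : ι → Type w} (x : X) (y : ∀ i, Y i) :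
    X ⊕ (Σ i, Y i) → X ⊕ (Σ i, Y i) → Prop
  | glue (i : ι) : WedgeRel x y (Sum.inr ⟨i, y i⟩) (Sum.inl x)

/-- The wedge `X ∨ ⋁ i, Y i` of a pointed space `(X, x)` with a family of pointed spaces
`(Y i, y i)`. -/
def Wedge {X : Type u} {ι : Type v} {Y : ι → Type w} (x : X) (y : ∀ i, Y i) : Type (max u v w) :=
  Quot (WedgeRel x y)

instance {X : Type u} {ι : Type v} {Y : ι → Type w} [TopologicalSpace X]
    [∀ i, TopologicalSpace (Y i)] (x : X) (y : ∀ i, Y i) : TopologicalSpace (Wedge x y) :=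
  inferInstanceAs (TopologicalSpace (Quot (WedgeRel x y)))

/-! ### The unions of links -/

/-- The complex `⋃ m ∈ M, Δ P_{<m} * Δ P_{>m}`. -/
def linkUnion {P : Type u} [PartialOrder P] (M : Set P) : PreAbstractSimplicialComplex P :=
  ⨆ m ∈ M, simplicialJoin (orderComplex (Set.Iio m)) (orderComplex (Set.Ioi m))

/-- The complex `⋃ m ∈ M, Δ P_{<m}`. -/
def lowerLinkUnion {P : Type u} [PartialOrder P] (M : Set P) : PreAbstractSimplicialComplex P :=
  ⨆ m ∈ M, orderComplex (Set.Iio m)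

theorem linkUnion_le {P : Type u} [PartialOrder P] {M : Set P} (hM : IsAntichain (· ≤ ·) M) :
    linkUnion M ≤ orderComplex Mᶜ := by
  refine iSup₂_le fun m hm s hs => ?_
  obtain ⟨hne, a, b, ha, hb, hab⟩ := hs
  have ha' : ∀ x ∈ (a : Set P), x < m := by
    rcases ha with rfl | ha
    · simp
    · exact fun x hx => ha.2.1 hx
  have hb' : ∀ x ∈ (b : Set P), m < x := by
    rcases hb with rfl | hb
    · simp
    · exact fun x hx => hb.2.1 hx
  have hac : IsChain (· ≤ ·) (a : Set P) := by
    rcases ha with rfl | ha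
    · simp
    · exact ha.2.2
  have hbc : IsChain (· ≤ ·) (b : Set P) := by
    rcases hb with rfl | hb
    · simp
    · exact hb.2.2
  refine ⟨hne, ?_, ?_⟩
  · rw [hab]
    rintro x (hx | hx) hxM
    · exact hM hxM hm (ha' x hx).ne (ha' x hx).le
    · exact hM hm hxM (hb' x hx).ne (hb' x hx).le
  · rw [hab, isChain_union]
    exact ⟨hac, hbc, fun x hx y hy _ => Or.inl ((ha' x hx).trans (hb' y hy)).le⟩

theorem lowerLinkUnion_le {P : Type u} [PartialOrder P] {M : Set P} (hM : ∀ m ∈ M, IsMax m) :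
    lowerLinkUnion M ≤ orderComplex Mᶜ := by
  refine iSup₂_le fun m hm s hs => ⟨hs.1, fun x hx hxM => ?_, hs.2.2⟩
  exact (hM x hxM).not_lt (hs.2.1 hx)

end PosetTopology

end

open PosetTopology

/-!
Since `M` is an antichain, every chain of `P` contains at most one element `m` of `M`, and the rest
of such a chain is a chain in `P_{<m} ∪ P_{>m}`, i.e. a simplex of the link of `m`. Hence `Δ P` is
obtained from `Δ P_{∉ M}` by attaching, for each `m ∈ M`, a cone with apex `m` along the inclusion
of the link (`nonempty_attachCones_homeomorph`; the comparison map is a continuous bijection from a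
compact space to a Hausdorff space). The link is the image of the topological join of `Δ P_{<m}`
and `Δ P_{>m}` under an injective map linear on joining segments (`joinToFun_injective`,
`exists_joinToFun_eq`).

The homotopy type of a space with cones attached depends only on the homotopy classes of the
attaching maps (`AttachCones.homotopyEquiv`). By hypothesis all attaching maps are homotopic to the
constant map `x`, and a cone attached along a constant map is a suspension wedged on at `x`
(`AttachCones.constHomeomorphWedge`).

If all elements of `M` are maximal, then `M` is an antichain and the link of `m` is `Δ P_{<m}`, so
the same argument applies without forming the join
(`nonempty_homotopyEquiv_wedge_of_links` covers both cases).
-/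

noncomputable section

namespace PosetTopology

universe u v w

/-! ### Attaching cones to a space -/

/-- Gluing relation for attaching to `X` a cone over each `Y i` along `f i : Y i → X`: the end
`Y i × {0}` is glued to `X` by `f i`, the end `Y i × {1}` is collapsed to the apex of the cone. -/
inductive ConesRel {X : Type u} {ι : Type v} {Y : ι → Type w} (f : ∀ i, Y i → X) :
    X ⊕ (Σ i, Unit ⊕ Y i × I) → X ⊕ (Σ i, Unit ⊕ Y i × I) → Prop
  | base (i : ι) (y : Y i) : ConesRel f (Sum.inr ⟨i, Sum.inr (y, 0)⟩) (Sum.inl (f i y))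
  | apex (i : ι) (y : Y i) :
      ConesRel f (Sum.inr ⟨i, Sum.inr (y, 1)⟩) (Sum.inr ⟨i, Sum.inl ()⟩)

/-- The space `X ∪ ⋃ i, C (Y i)` obtained from `X` by attaching a cone over each `Y i` along
`f i : Y i → X`. The apex of each cone is present even if `Y i` is empty, in which case attaching
the cone adds an isolated point. -/
def AttachCones {X : Type u} {ι : Type v} {Y : ι → Type w} (f : ∀ i, Y i → X) :
    Type (max u v w) :=
  Quot (ConesRel f)

namespace AttachCones

variable {X : Type u} {ι : Type v} {Y : ι → Type w}

instance [TopologicalSpace X] [∀ i, TopologicalSpace (Y i)] (f : ∀ i, Y i → X) :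
    TopologicalSpace (AttachCones f) :=
  inferInstanceAs (TopologicalSpace (Quot (ConesRel f)))

instance [TopologicalSpace X] [∀ i, TopologicalSpace (Y i)] [CompactSpace X] [Finite ι]
    [∀ i, CompactSpace (Y i)] (f : ∀ i, Y i → X) : CompactSpace (AttachCones f) :=
  inferInstanceAs (CompactSpace (Quot (ConesRel f)))

/-- The inclusion of the base space. -/
def base (f : ∀ i, Y i → X) (x : X) : AttachCones f := Quot.mk _ (Sum.inl x)

/-- The apex of the `i`-th cone. -/
def apex (f : ∀ i, Y i → X) (i : ι) : AttachCones f := Quot.mk _ (Sum.inr ⟨i, Sum.inl ()⟩)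

/-- The point of the `i`-th cone at height `t` over `y`; height `0` is the base, height `1` the
apex. -/
def pt (f : ∀ i, Y i → X) (i : ι) (y : Y i) (t : I) : AttachCones f :=
  Quot.mk _ (Sum.inr ⟨i, Sum.inr (y, t)⟩)

@[simp] theorem pt_zero (f : ∀ i, Y i → X) (i : ι) (y : Y i) : pt f i y 0 = base f (f i y) :=
  Quot.sound (.base i y)

@[simp] theorem pt_one (f : ∀ i, Y i → X) (i : ι) (y : Y i) : pt f i y 1 = apex f i :=
  Quot.sound (.apex i y)

/-- Every point is a base point, an apex, or lies strictly between the two ends of a cone. -/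
theorem cases_interior {f : ∀ i, Y i → X} {p : AttachCones f → Prop} (hbase : ∀ x, p (base f x))
    (hapex : ∀ i, p (apex f i)) (hpt : ∀ i y t, 0 < t → t < 1 → p (pt f i y t)) (c) : p c := by
  rcases c with ⟨x | ⟨i, ⟨⟩ | ⟨y, t⟩⟩⟩
  · exact hbase x
  · exact hapex i
  · change p (pt f i y t)
    rcases eq_or_ne t 0 with rfl | h0
    · simpa using hbase _
    rcases eq_or_ne t 1 with rfl | h1
    · simpa using hapex _
    exact hpt i y t (unitInterval.pos_iff_ne_zero.2 h0) (unitInterval.lt_one_iff_ne_one.2 h1)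

theorem ind {f : ∀ i, Y i → X} {p : AttachCones f → Prop} (hbase : ∀ x, p (base f x))
    (hapex : ∀ i, p (apex f i)) (hpt : ∀ i y t, p (pt f i y t)) (c) : p c :=
  cases_interior hbase hapex (fun i y t _ _ => hpt i y t) c

/-- The map out of `AttachCones f` given by compatible maps on the base, the apices and the
cones. -/
def lift {Z : Type*} (f : ∀ i, Y i → X) (b : X → Z) (a : ι → Z) (c : ∀ i, Y i → I → Z)
    (h0 : ∀ i y, c i y 0 = b (f i y)) (h1 : ∀ i y, c i y 1 = a i) : AttachCones f → Z :=
  Quot.lift (Sum.elim b fun q => Sum.elim (fun _ => a q.1) (fun r => c q.1 r.1 r.2) q.2) <| by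
    rintro _ _ (⟨i, y⟩ | ⟨i, y⟩)
    · exact h0 i y
    · exact h1 i y

section Topology

variable [TopologicalSpace X] [∀ i, TopologicalSpace (Y i)]

theorem continuous_base (f : ∀ i, Y i → X) : Continuous (base f) :=
  continuous_quot_mk.comp continuous_inl

theorem continuous_pt (f : ∀ i, Y i → X) (i : ι) :
    Continuous fun q : Y i × I => pt f i q.1 q.2 :=
  continuous_quot_mk.comp (continuous_inr.comp (continuous_sigmaMk.comp continuous_inr))

theorem continuous_lift {Z : Type*} [TopologicalSpace Z] {f : ∀ i, Y i → X} {b : X → Z}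
    {a : ι → Z} {c : ∀ i, Y i → I → Z} (h0 : ∀ i y, c i y 0 = b (f i y))
    (h1 : ∀ i y, c i y 1 = a i) (hb : Continuous b)
    (hc : ∀ i, Continuous fun q : Y i × I => c i q.1 q.2) :
    Continuous (lift f b a c h0 h1) :=
  continuous_quot_lift _ <| hb.sumElim <| continuous_sigma fun i =>
    show Continuous (Sum.elim (fun _ => a i) fun r : Y i × I => c i r.1 r.2) from
      continuous_const.sumElim (hc i)

/-! ### Homotopy invariance in the attaching maps -/

variable {f g : ∀ i, C(Y i, X)}

/-- The lower half of each cone follows the homotopy `H i` in the base, the upper half is stretched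
over the whole cone. -/
def slide (H : ∀ i, (f i).Homotopy (g i)) (i : ι) (y : Y i) (t : I) :
    AttachCones fun i => (g i : Y i → X) :=
  if 2 * (t : ℝ) ≤ 1 then base _ (H i (Set.projIcc 0 1 zero_le_one (2 * (t : ℝ)), y))
  else pt _ i y (Set.projIcc 0 1 zero_le_one (2 * (t : ℝ) - 1))

theorem continuous_slide (H : ∀ i, (f i).Homotopy (g i)) (i : ι) :
    Continuous fun q : Y i × I => slide H i q.1 q.2 := by
  refine Continuous.if_le ?_ ?_ (by fun_prop) (by fun_prop) ?_
  · exact (continuous_base _).comp ((H i).continuous.comp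
      (((continuous_projIcc (h := zero_le_one)).comp (by fun_prop)).prodMk continuous_fst))
  · exact (continuous_pt _ i).comp
      (continuous_fst.prodMk ((continuous_projIcc (h := zero_le_one)).comp (by fun_prop)))
  · rintro ⟨y, t⟩ h
    simp only at h
    simp [h]

/-- The comparison map between the spaces with cones attached along homotopic maps. -/
def map (H : ∀ i, (f i).Homotopy (g i)) :
    C(AttachCones fun i => (f i : Y i → X), AttachCones fun i => (g i : Y i → X)) where
  toFun := lift _ (base _) (apex _) (slide H) (fun i y => by simp [slide])
    (fun i y => by
      have h : ¬ (2 : ℝ) ≤ 1 := by norm_num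
      have h2 : (2 : ℝ) - 1 = 1 := by norm_num
      simp [slide, h, h2])
  continuous_toFun := continuous_lift _ _ (continuous_base _) (continuous_slide H)

/-- A homotopy from the `i`-th cone to itself, from the identity (`r = 0`) to going along `H i` and
back, followed by the reparametrized cone (`r = 1`): at time `r` the part of height at most `3r/4`
goes along `H i` up to at most time `r` and back, and the rest is stretched over the cone. -/
def unslide (H : ∀ i, (f i).Homotopy (g i)) (i : ι) (y : Y i) (t r : I) :
    AttachCones fun i => (f i : Y i → X) :=
  if 4 * (t : ℝ) ≤ 3 * r then
    base _ (H i (Set.projIcc 0 1 zero_le_one (min (2 * (t : ℝ)) (3 * r - 4 * t)), y))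
  else pt _ i y (Set.projIcc 0 1 zero_le_one ((4 * (t : ℝ) - 3 * r) / (4 - 3 * r)))

theorem continuous_unslide (H : ∀ i, (f i).Homotopy (g i)) (i : ι) :
    Continuous fun q : (Y i × I) × I => unslide H i q.1.1 q.1.2 q.2 := by
  refine Continuous.if_le ?_ ?_ (by fun_prop) (by fun_prop) ?_
  · exact (continuous_base _).comp ((H i).continuous.comp
      (((continuous_projIcc (h := zero_le_one)).comp (by fun_prop)).prodMk (by fun_prop)))
  · refine (continuous_pt _ i).comp
      (Continuous.prodMk (by fun_prop) ((continuous_projIcc (h := zero_le_one)).comp ?_))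
    refine Continuous.div (by fun_prop) (by fun_prop) fun q => ?_
    have := q.2.2.2
    linarith
  · rintro ⟨⟨y, t⟩, r⟩ h
    simp only at h
    have ht := t.2.1
    simp [h, ht]

theorem unslide_bottom (H : ∀ i, (f i).Homotopy (g i)) (i : ι) (y : Y i) (r : I) :
    unslide H i y 0 r = base _ (f i y) := by
  have hr := r.2.1
  simp [unslide, hr]

theorem unslide_top (H : ∀ i, (f i).Homotopy (g i)) (i : ι) (y : Y i) (r : I) :
    unslide H i y 1 r = apex _ i := by
  have hr := r.2.2
  have h : ¬ (4 : ℝ) ≤ 3 * r := by linarith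
  have h2 : (4 - 3 * (r : ℝ)) / (4 - 3 * r) = 1 := div_self (by linarith)
  simp [unslide, h, h2]

theorem unslide_start (H : ∀ i, (f i).Homotopy (g i)) (i : ι) (y : Y i) (t : I) :
    unslide H i y t 0 = pt _ i y t := by
  rcases eq_or_ne t 0 with rfl | h0
  · simp [unslide_bottom]
  · have h : ¬ 4 * (t : ℝ) ≤ 0 := by
      have : (0 : ℝ) < t := unitInterval.pos_iff_ne_zero.2 h0
      linarith
    simp [unslide, h]

theorem unslide_end (H : ∀ i, (f i).Homotopy (g i)) (i : ι) (y : Y i) (t : I) :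
    unslide H i y t 1 = map (fun i => (H i).symm) (slide H i y t) := by
  obtain ⟨ht0, ht1⟩ := t.2
  unfold slide
  split_ifs with h
  · have h1 : 4 * (t : ℝ) ≤ 3 := by linarith
    have h2 : 2 * (t : ℝ) ≤ 3 - 4 * t := by linarith
    simp only [unslide, Set.Icc.coe_one, mul_one, h1, if_true, min_eq_left h2]
    rfl
  · have hs : (Set.projIcc (0 : ℝ) 1 zero_le_one (2 * (t : ℝ) - 1) : ℝ) = 2 * t - 1 := by
      rw [Set.projIcc_of_mem zero_le_one ⟨by linarith, by linarith⟩]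
    change _ = slide (fun i => (H i).symm) i y _
    unfold slide unslide
    rw [hs, Set.Icc.coe_one, mul_one]
    by_cases h1 : 4 * (t : ℝ) ≤ 3
    · have h2 : 2 * (2 * (t : ℝ) - 1) ≤ 1 := by linarith
      rw [if_pos h1, if_pos h2, ContinuousMap.Homotopy.symm_apply, min_eq_right (by linarith)]
      congr 3
      rw [Set.projIcc_of_mem zero_le_one ⟨by linarith, by linarith⟩,
        Set.projIcc_of_mem zero_le_one ⟨by linarith, by linarith⟩]
      ext
      simp only [unitInterval.coe_symm_eq]
      ring
    · have h2 : ¬ 2 * (2 * (t : ℝ) - 1) ≤ 1 := by linarith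
      rw [if_neg h1, if_neg h2]
      congr 2
      ring

theorem map_symm_comp_map (H : ∀ i, (f i).Homotopy (g i)) :
    ((map fun i => (H i).symm).comp (map H)).Homotopic (ContinuousMap.id _) := by
  -- Adjoint form of the homotopy, so that continuity can be checked before passing to the quotient.
  let F : AttachCones (fun i => (f i : Y i → X)) → C(I, AttachCones fun i => (f i : Y i → X)) :=
    lift _ (fun x => .const _ (base _ x)) (fun i => .const _ (apex _ i))
      (fun i y t => ContinuousMap.curry ⟨_, continuous_unslide H i⟩ (y, t))
      (fun i y => by ext r; exact unslide_bottom H i y r)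
      (fun i y => by ext r; exact unslide_top H i y r)
  have hF : Continuous F := continuous_lift _ _
    ((ContinuousMap.continuous_const').comp (continuous_base _))
    fun i => (ContinuousMap.curry ⟨_, continuous_unslide H i⟩).continuous
  refine ContinuousMap.Homotopic.symm ⟨⟨⟨fun q => F q.2 q.1, by fun_prop⟩, fun c => ?_, fun c => ?_⟩⟩
  · induction c using ind with
    | hbase x => rfl
    | hapex i => rfl
    | hpt i y t => exact unslide_start H i y t
  · induction c using ind with
    | hbase x => rfl
    | hapex i => rfl
    | hpt i y t => exact unslide_end H i y t

/-- Attaching cones along homotopic maps gives homotopy equivalent spaces. -/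
def homotopyEquiv (H : ∀ i, (f i).Homotopy (g i)) :
    (AttachCones fun i => (f i : Y i → X)) ≃ₕ AttachCones fun i => (g i : Y i → X) where
  toFun := map H
  invFun := map fun i => (H i).symm
  left_inv := map_symm_comp_map H
  right_inv := by simpa using map_symm_comp_map fun i => (H i).symm

/-! ### Cones attached at a point -/

/-- The `i`-th suspension in the space with cones attached along the constant maps `x`. -/
def ofSuspension (x : X) (i : ι) :
    Suspension (Y i) → AttachCones fun (i : ι) (_ : Y i) => x :=
  Quot.lift (Sum.elim (fun e => bif e then apex _ i else base _ x) fun q => pt _ i q.1 q.2) <| by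
    rintro _ _ (y | y)
    · exact pt_zero _ i y
    · exact pt_one _ i y

theorem continuous_ofSuspension (x : X) (i : ι) : Continuous (ofSuspension (Y := Y) x i) :=
  continuous_quot_lift _ (continuous_of_discreteTopology.sumElim (continuous_pt _ i))

/-- Attaching the cones along constant maps gives the wedge with the suspensions: the bottom pole
of each suspension becomes the base point, the top pole the apex. -/
def constHomeomorphWedge (x : X) :
    AttachCones (fun (i : ι) (_ : Y i) => x) ≃ₜ Wedge x fun i => Suspension.pole (Y i) where
  toFun := lift _ (fun z => Quot.mk _ (Sum.inl z))
    (fun i => Quot.mk _ (Sum.inr ⟨i, Quot.mk _ (Sum.inl true)⟩))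
    (fun i y t => Quot.mk _ (Sum.inr ⟨i, Quot.mk _ (Sum.inr (y, t))⟩))
    (fun i y => by
      rw [Quot.sound (SuspensionRel.bottom y)]
      exact Quot.sound (WedgeRel.glue i))
    (fun i y => by rw [Quot.sound (SuspensionRel.top y)])
  invFun := Quot.lift (Sum.elim (base _) fun s => ofSuspension x s.1 s.2)
    (by rintro _ _ ⟨i⟩; rfl)
  left_inv c := by
    induction c using ind with
    | hbase x => rfl
    | hapex i => rfl
    | hpt i y t => rfl
  right_inv c := by
    rcases c with ⟨z | ⟨i, ⟨(_ | _) | ⟨y, t⟩⟩⟩⟩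
    · rfl
    · exact (Quot.sound (WedgeRel.glue i)).symm
    · rfl
    · rfl
  continuous_toFun := continuous_lift _ _ (continuous_quot_mk.comp continuous_inl) fun i =>
    continuous_quot_mk.comp <| continuous_inr.comp <| continuous_sigmaMk.comp <|
      continuous_quot_mk.comp continuous_inr
  continuous_invFun := continuous_quot_lift _ <| (continuous_base _).sumElim <|
    continuous_sigma (continuous_ofSuspension x)

/-- If all attaching maps are homotopic to the constant map `x`, then attaching the cones amounts
to wedging suspensions to `X` at `x`. -/
theorem nonempty_homotopyEquiv_wedge {x : X}
    (hf : ∀ i, (f i).Homotopic (ContinuousMap.const (Y i) x)) :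
    Nonempty ((AttachCones fun i => (f i : Y i → X)) ≃ₕ
      Wedge x fun i => Suspension.pole (Y i)) :=
  ⟨(homotopyEquiv fun i => (hf i).some).trans (constHomeomorphWedge x).toHomotopyEquiv⟩

end Topology

end AttachCones

/-! ### Points of realizations in barycentric coordinates -/

section Mass

variable {V : Type u} [Fintype V] {z w : V → ℝ} {S : Set V}

/-- The total weight that the barycentric coordinates `z` give to the vertices in `S`. -/
def mass (S : Set V) (z : V → ℝ) : ℝ := ∑ p, S.indicator z p

theorem mass_nonneg (hz : z ∈ stdSimplex ℝ V) : 0 ≤ mass S z :=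
  Finset.sum_nonneg fun p _ => Set.indicator_nonneg (fun q _ => hz.1 q) p

theorem mass_add_mass_compl (hz : z ∈ stdSimplex ℝ V) : mass S z + mass Sᶜ z = 1 := by
  rw [mass, mass, ← Finset.sum_add_distrib, ← hz.2]
  exact Finset.sum_congr rfl fun p _ => congrFun (Set.indicator_self_add_compl S z) p

theorem eq_zero_of_mass_eq_zero (hz : z ∈ stdSimplex ℝ V) (h : mass S z = 0) {p : V}
    (hp : p ∈ S) : z p = 0 := by
  have := (Finset.sum_eq_zero_iff_of_nonneg fun _ _ =>
    Set.indicator_nonneg (fun q _ => hz.1 q) _).1 h p (Finset.mem_univ p)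
  rwa [Set.indicator_of_mem hp] at this

theorem mass_eq_zero (h : Disjoint (Function.support z) S) : mass S z = 0 :=
  Finset.sum_eq_zero fun _ _ => Set.indicator_apply_eq_zero.2 fun hp =>
    by_contra fun h0 => Set.disjoint_left.1 h h0 hp

theorem mass_eq_one (hz : z ∈ stdSimplex ℝ V) (h : Function.support z ⊆ S) : mass S z = 1 := by
  have := mass_add_mass_compl (S := S) hz
  rwa [mass_eq_zero (Set.disjoint_compl_right_iff_subset.2 h), add_zero] at this

theorem mass_add_smul (a b : ℝ) : mass S (a • z + b • w) = a * mass S z + b * mass S w := by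
  simp only [mass, Finset.mul_sum, ← Finset.sum_add_distrib]
  refine Finset.sum_congr rfl fun p _ => ?_
  by_cases hp : p ∈ S <;> simp [hp]

/-- The projection of `z` to the face spanned by the vertices in `S`; it is only meaningful if
`mass S z ≠ 0`. -/
def normalize (S : Set V) (z : V → ℝ) : V → ℝ := (mass S z)⁻¹ • S.indicator z

theorem normalize_mem_stdSimplex (hz : z ∈ stdSimplex ℝ V) (h : mass S z ≠ 0) :
    normalize S z ∈ stdSimplex ℝ V := by
  refine ⟨fun p => mul_nonneg (inv_nonneg.2 (mass_nonneg hz))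
    (Set.indicator_nonneg (fun q _ => hz.1 q) p), ?_⟩
  simp only [normalize, Pi.smul_apply, smul_eq_mul, ← Finset.mul_sum]
  exact inv_mul_cancel₀ h

theorem support_normalize_subset : Function.support (normalize S z) ⊆ Function.support z ∩ S := by
  intro p hp
  have h : S.indicator z p ≠ 0 := fun h => hp (by simp [normalize, h])
  exact ⟨fun h0 => h (by simp [h0]), Set.mem_of_indicator_ne_zero h⟩

theorem mass_smul_normalize (h : mass S z ≠ 0) : mass S z • normalize S z = S.indicator z := by
  rw [normalize, smul_smul, mul_inv_cancel₀ h, one_smul]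

/-- A point is the convex combination of its projections to two complementary faces. -/
theorem eq_smul_normalize_add (hz : z ∈ stdSimplex ℝ V) {T : Set V}
    (hST : Disjoint S T) (hsupp : Function.support z ⊆ S ∪ T) (hS : mass S z ≠ 0)
    (hT : mass T z ≠ 0) :
    (1 - mass T z) • normalize S z + mass T z • normalize T z = z := by
  have hz' : S.indicator z + T.indicator z = z := by
    refine (Set.indicator_union_of_disjoint hST z).symm.trans ?_
    exact Set.indicator_eq_self.2 hsupp
  have h1 : mass S z + mass T z = 1 := by
    rw [mass, mass, ← Finset.sum_add_distrib, ← hz.2]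
    exact Finset.sum_congr rfl fun p _ => congrFun hz' p
  rw [← h1, add_sub_cancel_right, mass_smul_normalize hS, mass_smul_normalize hT, hz']

end Mass

instance {V : Type u} [Fintype V] (K : PreAbstractSimplicialComplex V) :
    CompactSpace (realization K) := by
  have h : realization K = stdSimplex ℝ V ∩
      ⋃ s ∈ K.faces, ⋂ p ∈ (s : Set V)ᶜ, {z : V → ℝ | z p = 0} := by
    ext z
    simp only [realization, Function.support_subset_iff', Set.mem_ofPred_eq, Set.mem_inter_iff,
      Set.mem_iUnion, Set.mem_iInter, Set.mem_compl_iff, exists_prop]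
  rw [← isCompact_iff_compactSpace, h]
  refine (isCompact_stdSimplex ℝ V).inter_right (K.faces.toFinite.isClosed_biUnion fun s _ => ?_)
  exact isClosed_biInter fun p _ => isClosed_eq (continuous_apply p) continuous_const

section Poset

variable {P : Type u} [PartialOrder P] [Fintype P]

theorem mem_realization_orderComplex {S : Set P} {z : P → ℝ} :
    z ∈ realization (orderComplex S) ↔ z ∈ stdSimplex ℝ P ∧ Function.support z ⊆ S ∧
      IsChain (· ≤ ·) (Function.support z) := by
  constructor
  · rintro ⟨hz, s, hs, hzs⟩
    exact ⟨hz, hzs.trans hs.2.1, hs.2.2.mono hzs⟩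
  · rintro ⟨hz, hS, hc⟩
    refine ⟨hz, (Set.toFinite (Function.support z)).toFinset, ⟨?_, ?_, ?_⟩, ?_⟩
    · rw [Set.Finite.toFinset_nonempty, Function.support_nonempty_iff]
      rintro rfl
      simpa using hz.2
    · simpa using hS
    · simpa using hc
    · simp

/-- The set of elements comparable to `m` and distinct from it: the vertices of the link of `m` in
the order complex. -/
def strictlyComparable (m : P) : Set P := Set.Iio m ∪ Set.Ioi m

theorem mem_realization_linkUnion {M : Set P} {m : P} (hm : m ∈ M) {z : P → ℝ}
    (hz : z ∈ stdSimplex ℝ P) (hc : IsChain (· ≤ ·) (Function.support z))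
    (hl : Function.support z ⊆ strictlyComparable m) : z ∈ realization (linkUnion M) := by
  classical
  refine realization_mono (le_iSup₂_of_le m hm le_rfl) ?_
  -- The support of `z` splits into its parts below and above `m`, each empty or a chain.
  have key : ∀ T : Set P, ∀ a : Finset P, (∀ p ∈ a, z p ≠ 0 ∧ p ∈ T) →
      a = ∅ ∨ a ∈ (orderComplex T).faces := fun T a ha =>
    a.eq_empty_or_nonempty.imp_right fun hne =>
      ⟨hne, fun p hp => (ha p hp).2, hc.mono fun p hp => (ha p hp).1⟩
  have hne : (Finset.univ.filter fun p => z p ≠ 0).Nonempty := by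
    by_contra h
    have h0 : ∀ p, z p = 0 := by simpa [Finset.filter_eq_empty_iff] using h
    simpa [h0] using hz.2
  refine ⟨hz, Finset.univ.filter fun p => z p ≠ 0,
    ⟨hne, Finset.univ.filter fun p => z p ≠ 0 ∧ p < m, Finset.univ.filter fun p => z p ≠ 0 ∧ m < p,
      key _ _ (by simp), key _ _ (by simp), ?_⟩, by intro p hp; simpa using hp⟩
  ext p
  have := @hl p
  simp only [strictlyComparable, Function.mem_support, Set.mem_union, Set.mem_Iio,
    Set.mem_Ioi] at this
  simp only [Finset.coe_filter, Finset.mem_univ, true_and, Set.mem_ofPred_eq, Set.mem_union]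
  tauto

theorem normalize_mem_realization {S T : Set P} {z : P → ℝ}
    (hz : z ∈ realization (orderComplex S)) (h : mass T z ≠ 0) :
    normalize T z ∈ realization (orderComplex (S ∩ T)) := by
  rw [mem_realization_orderComplex] at hz ⊢
  have hs := support_normalize_subset (S := T) (z := z)
  exact ⟨normalize_mem_stdSimplex hz.1 h, hs.trans (Set.inter_subset_inter_left _ hz.2.1),
    hz.2.2.mono (hs.trans Set.inter_subset_left)⟩

/-- A convex combination of points of the order complexes of two sets lies in the order complex of
any set containing both, if all elements of the first are comparable to all elements of the
second. -/
theorem combination_mem_realization {A B S : Set P} {z w : P → ℝ}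
    (hz : z ∈ realization (orderComplex A)) (hw : w ∈ realization (orderComplex B))
    (hA : A ⊆ S) (hB : B ⊆ S) (hAB : ∀ a ∈ A, ∀ b ∈ B, a ≤ b ∨ b ≤ a) (t : I) :
    (1 - (t : ℝ)) • z + (t : ℝ) • w ∈ realization (orderComplex S) := by
  rw [mem_realization_orderComplex] at hz hw ⊢
  have hs : Function.support ((1 - (t : ℝ)) • z + (t : ℝ) • w) ⊆
      Function.support z ∪ Function.support w := by
    intro p hp
    by_contra h
    simp only [Set.mem_union, Function.mem_support, not_or, not_not] at h
    exact hp (by simp [h.1, h.2])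
  refine ⟨convex_stdSimplex ℝ P hz.1 hw.1 (sub_nonneg.2 t.2.2) t.2.1 (by ring),
    hs.trans (Set.union_subset (hz.2.1.trans hA) (hw.2.1.trans hB)), IsChain.mono hs ?_⟩
  exact isChain_union.2 ⟨hz.2.2, hw.2.2, fun a ha b hb _ => hAB a (hz.2.1 ha) b (hw.2.1 hb)⟩

theorem single_mem_realization [DecidableEq P] {S : Set P} {m : P} (hm : m ∈ S) :
    (Pi.single m 1 : P → ℝ) ∈ realization (orderComplex S) := by
  rw [mem_realization_orderComplex]
  have h : Function.support (Pi.single m 1 : P → ℝ) ⊆ {m} := Pi.support_single_subset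
  exact ⟨single_mem_stdSimplex ℝ m, h.trans (Set.singleton_subset_iff.2 hm),
    (IsChain.singleton).mono h⟩

/-! ### The order complex as a union of cones over links -/

section Cones

variable {M : Set P} {Y : M → Type v} [∀ m, TopologicalSpace (Y m)]
  (f : ∀ m, C(Y m, realization (orderComplex Mᶜ)))

open Classical in
/-- The map from `Δ P_{∉ M}` with cones attached to `P → ℝ`, sending the apices to the vertices in
`M` and the cones linearly to segments. -/
def conesToFun : (AttachCones fun m => (f m : Y m → realization (orderComplex Mᶜ))) → P → ℝ :=
  AttachCones.lift _ (fun z => z) (fun m => (Pi.single (m : P) 1 : P → ℝ))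
    (fun m y t => (1 - (t : ℝ)) • (f m y : P → ℝ) + (t : ℝ) • (Pi.single (m : P) 1 : P → ℝ))
    (fun m y => by simp) (fun m y => by simp)

theorem continuous_conesToFun : Continuous (conesToFun f) :=
  AttachCones.continuous_lift _ _ continuous_subtype_val fun m => by fun_prop

variable {f}

theorem realization_compl_apply_eq_zero (z : realization (orderComplex Mᶜ)) {m : P} (hm : m ∈ M) :
    (z : P → ℝ) m = 0 :=
  by_contra fun h => (mem_realization_orderComplex.1 z.2).2.1 h hm

open Classical in
theorem conesToFun_apex_apply (m m' : M) :
    conesToFun f (AttachCones.apex _ m) m' = if m' = m then 1 else 0 := by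
  change (Pi.single (m : P) 1 : P → ℝ) m' = _
  simp [Pi.single_apply, Subtype.ext_iff]

open Classical in
theorem conesToFun_pt_apply (m m' : M) (y : Y m) (t : I) :
    conesToFun f (AttachCones.pt _ m y t) m' = if m' = m then (t : ℝ) else 0 := by
  change (1 - (t : ℝ)) * (f m y : P → ℝ) m' + (t : ℝ) * (Pi.single (m : P) 1 : P → ℝ) m' = _
  simp [Pi.single_apply, Subtype.ext_iff, realization_compl_apply_eq_zero (f m y) m'.2]

theorem conesToFun_base_apply (z) (m : M) : conesToFun f (AttachCones.base _ z) m = 0 :=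
  realization_compl_apply_eq_zero z m.2

/-- The coordinates at the vertices in `M` determine the cone and the height in it. -/
theorem conesToFun_injective (hinj : ∀ m, Function.Injective (f m)) :
    Function.Injective (conesToFun f) := by
  classical
  intro c d h
  have hval : ∀ m : M, conesToFun f c m = conesToFun f d m := fun m => congrFun h m
  induction c using AttachCones.cases_interior with
  | hbase z =>
    induction d using AttachCones.cases_interior with
    | hbase w => exact congrArg _ (Subtype.ext h)
    | hapex n => simpa [conesToFun_base_apply, conesToFun_apex_apply] using hval n
    | hpt n y s h0 h1 =>
      have := hval n
      simp only [conesToFun_base_apply, conesToFun_pt_apply, if_true] at this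
      exact absurd (Subtype.ext this) h0.ne
  | hapex m =>
    have hm := hval m
    induction d using AttachCones.cases_interior with
    | hbase w => simp [conesToFun_base_apply, conesToFun_apex_apply] at hm
    | hapex n =>
      by_cases hmn : m = n
      · rw [hmn]
      · simp [conesToFun_apex_apply, hmn] at hm
    | hpt n y s h0 h1 =>
      by_cases hmn : m = n
      · simp only [conesToFun_apex_apply, conesToFun_pt_apply, hmn, if_true] at hm
        exact absurd (Subtype.ext hm.symm) h1.ne
      · simp [conesToFun_apex_apply, conesToFun_pt_apply, hmn] at hm
  | hpt m x t h0 h1 =>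
    have hm := hval m
    have ht : (t : ℝ) ≠ 0 := fun h => h0.ne' (Subtype.ext h)
    induction d using AttachCones.cases_interior with
    | hbase w => simp [conesToFun_base_apply, conesToFun_pt_apply, h0.ne'] at hm
    | hapex n =>
      by_cases hmn : m = n
      · simp only [conesToFun_apex_apply, conesToFun_pt_apply, hmn, if_true] at hm
        exact absurd (Subtype.ext hm) h1.ne
      · simp [conesToFun_apex_apply, conesToFun_pt_apply, hmn, h0.ne'] at hm
    | hpt n y s _ _ =>
      by_cases hmn : m = n
      · subst hmn
        simp only [conesToFun_pt_apply, if_true] at hm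
        obtain rfl : t = s := Subtype.ext hm
        have h' := add_right_cancel (show (1 - (t : ℝ)) • (f m x : P → ℝ) + _ =
          (1 - (t : ℝ)) • (f m y : P → ℝ) + _ from h)
        have ht1 : (1 - (t : ℝ)) ≠ 0 := fun h => h1.ne (Subtype.ext (sub_eq_zero.1 h).symm)
        rw [hinj m (Subtype.ext (smul_right_injective _ ht1 h'))]
      · simp [conesToFun_pt_apply, hmn, h0.ne'] at hm

theorem conesToFun_mem_realization
    (hrange : ∀ m y, Function.support (f m y : P → ℝ) ⊆ strictlyComparable (m : P)) (c) :
    conesToFun f c ∈ realization (orderComplex (Set.univ : Set P)) := by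
  classical
  induction c using AttachCones.ind with
  | hbase z =>
    obtain ⟨hz, -, hc⟩ := mem_realization_orderComplex.1 z.2
    exact mem_realization_orderComplex.2 ⟨hz, Set.subset_univ _, hc⟩
  | hapex m => exact single_mem_realization (Set.mem_univ _)
  | hpt m y t =>
    obtain ⟨hz, -, hc⟩ := mem_realization_orderComplex.1 (f m y).2
    refine combination_mem_realization (mem_realization_orderComplex.2 ⟨hz, hrange m y, hc⟩)
      (single_mem_realization (Set.mem_singleton (m : P))) (Set.subset_univ _) (Set.subset_univ _)
      ?_ t
    rintro a (ha | ha) b rfl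
    · exact Or.inl (le_of_lt ha)
    · exact Or.inr (le_of_lt ha)

/-- As `M` is an antichain, a chain contains at most one element `m` of `M`, and its other elements
span a simplex of the link of `m`. -/
theorem exists_conesToFun_eq (hM : IsAntichain (· ≤ ·) M)
    (hrange : ∀ (m : M) (z : realization (orderComplex Mᶜ)),
      Function.support (z : P → ℝ) ⊆ strictlyComparable (m : P) → ∃ y, f m y = z)
    {z : P → ℝ} (hz : z ∈ realization (orderComplex (Set.univ : Set P))) :
    ∃ c, conesToFun f c = z := by
  classical
  obtain ⟨hz1, -, hc⟩ := mem_realization_orderComplex.1 hz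
  by_cases h : ∃ m ∈ M, z m ≠ 0
  swap
  · push Not at h
    exact ⟨AttachCones.base _ ⟨z, mem_realization_orderComplex.2
      ⟨hz1, fun p hp hpM => hp (h p hpM), hc⟩⟩, rfl⟩
  obtain ⟨m, hm, hzm⟩ := h
  have hmass : mass {m} z = z m := by simp [mass, Set.indicator_apply]
  have hind : Set.indicator {m} z = z m • Pi.single m 1 := by
    ext p
    by_cases hp : p = m <;> simp [hp]
  have hnorm : normalize {m} z = Pi.single m 1 := by
    rw [normalize, hmass, hind, smul_smul, inv_mul_cancel₀ hzm, one_smul]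
  by_cases h0 : mass {m}ᶜ z = 0
  · refine ⟨AttachCones.apex _ ⟨m, hm⟩, ?_⟩
    have h1 := mass_add_mass_compl (S := {m}) hz1
    rw [h0, add_zero, hmass] at h1
    change Pi.single m 1 = z
    ext p
    by_cases hp : p = m
    · simp [hp, h1]
    · simp [hp, eq_zero_of_mass_eq_zero hz1 h0 hp]
  · have hcomp : Function.support (normalize {m}ᶜ z) ⊆ strictlyComparable m := fun p hp => by
      obtain ⟨hp, hpm⟩ := support_normalize_subset hp
      exact (hc.total hp hzm).imp (fun h => lt_of_le_of_ne h hpm)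
        fun h => lt_of_le_of_ne h (Ne.symm hpm)
    have hn := mem_realization_orderComplex.1 (normalize_mem_realization hz h0)
    obtain ⟨y, hy⟩ := hrange ⟨m, hm⟩ ⟨_, mem_realization_orderComplex.2 ⟨hn.1, fun p hp hpM =>
      (hcomp hp).elim (fun h => hM hpM hm h.ne h.le) fun h => hM hm hpM h.ne h.le, hn.2.2⟩⟩ hcomp
    have hle : z m ≤ 1 := by
      have h1 := mass_add_mass_compl (S := {m}) hz1
      have h2 := mass_nonneg (S := {m}ᶜ) hz1
      linarith
    refine ⟨AttachCones.pt _ ⟨m, hm⟩ y ⟨z m, hz1.1 m, hle⟩, ?_⟩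
    change (1 - z m) • (f ⟨m, hm⟩ y : P → ℝ) + z m • Pi.single m 1 = z
    rw [hy, ← hnorm, ← hmass]
    exact eq_smul_normalize_add hz1 disjoint_compl_left
      (by rw [Set.compl_union_self]; exact Set.subset_univ _) h0 (hmass ▸ hzm)

/-- If each `f m` is an embedding onto the link of `m`, then attaching cones along `f` yields the
whole order complex. -/
theorem nonempty_attachCones_homeomorph (hM : IsAntichain (· ≤ ·) M) [∀ m, CompactSpace (Y m)]
    (hinj : ∀ m, Function.Injective (f m))
    (hrange : ∀ (m : M) (z : realization (orderComplex Mᶜ)),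
      z ∈ Set.range (f m) ↔ Function.support (z : P → ℝ) ⊆ strictlyComparable (m : P)) :
    Nonempty ((AttachCones fun m => (f m : Y m → realization (orderComplex Mᶜ))) ≃ₜ
      realization (orderComplex (Set.univ : Set P))) := by
  have hmem := conesToFun_mem_realization fun m y => (hrange m (f m y)).1 ⟨y, rfl⟩
  let g : (AttachCones fun m => (f m : Y m → realization (orderComplex Mᶜ))) →
      realization (orderComplex (Set.univ : Set P)) := fun c => ⟨conesToFun f c, hmem c⟩
  have hg : Function.Bijective g :=
    ⟨fun c d h => conesToFun_injective hinj (congrArg Subtype.val h), fun z =>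
      (exists_conesToFun_eq hM (fun m w hw => (hrange m w).2 hw) z.2).imp fun c h =>
        Subtype.ext h⟩
  exact ⟨Continuous.homeoOfEquivCompactToT2 (f := Equiv.ofBijective g hg)
    ((continuous_conesToFun f).subtype_mk hmem)⟩

end Cones

/-- The general form of the wedge decomposition: `Y m` is any compact model of the link of `m`, and
`K` any subcomplex that contains the links and is contractible inside `Δ P_{∉ M}`. -/
theorem nonempty_homotopyEquiv_wedge_of_links {M : Set P} (hM : IsAntichain (· ≤ ·) M)
    {K : PreAbstractSimplicialComplex P} (hK : K ≤ orderComplex Mᶜ)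
    (x : realization (orderComplex Mᶜ))
    (hx : (ContinuousMap.inclusion (realization_mono hK)).Homotopic
      (ContinuousMap.const (realization K) x))
    {Y : M → Type v} [∀ m, TopologicalSpace (Y m)] [∀ m, CompactSpace (Y m)]
    (j : ∀ m, C(Y m, realization K)) (hinj : ∀ m, Function.Injective (j m))
    (hrange : ∀ (m : M), ∀ z ∈ realization (orderComplex Mᶜ),
      (∃ y, (j m y : P → ℝ) = z) ↔ Function.support z ⊆ strictlyComparable (m : P)) :
    Nonempty (realization (orderComplex (Set.univ : Set P)) ≃ₕ
      Wedge x fun m => Suspension.pole (Y m)) := by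
  obtain ⟨e⟩ := nonempty_attachCones_homeomorph
    (f := fun m => (ContinuousMap.inclusion (realization_mono hK)).comp (j m)) hM
    (fun m => (Set.inclusion_injective (realization_mono hK)).comp (hinj m)) fun m z => by
      rw [← hrange m z z.2]
      exact exists_congr fun y => Subtype.ext_iff
  obtain ⟨e'⟩ := AttachCones.nonempty_homotopyEquiv_wedge (x := x)
    (f := fun m => (ContinuousMap.inclusion (realization_mono hK)).comp (j m)) fun m =>
      hx.comp (ContinuousMap.Homotopic.refl (j m))
  exact ⟨e.symm.toHomotopyEquiv.trans e'⟩

/-! ### The link of an element as a join -/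

/-- The map from the topological join to `P → ℝ` that is linear on the joining segments. -/
def joinToFun (m : P) : Join (realization (orderComplex (Set.Iio m)))
    (realization (orderComplex (Set.Ioi m))) → P → ℝ :=
  Quot.lift (Sum.elim (Sum.elim (fun a => a) fun b => b) fun q =>
    (1 - (q.2.2 : ℝ)) • (q.1 : P → ℝ) + (q.2.2 : ℝ) • (q.2.1 : P → ℝ)) <| by
      rintro _ _ (⟨a, b⟩ | ⟨a, b⟩) <;> simp

theorem continuous_joinToFun (m : P) : Continuous (joinToFun m) :=
  continuous_quot_lift _ <|
    (continuous_subtype_val.sumElim continuous_subtype_val).sumElim (by fun_prop)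

/-- Every point of a join lies in one of the two factors or strictly between them. -/
theorem Join.cases_interior {X : Type v} {Y : Type w} {p : Join X Y → Prop}
    (hl : ∀ x, p (Quot.mk _ (Sum.inl (Sum.inl x)))) (hr : ∀ y, p (Quot.mk _ (Sum.inl (Sum.inr y))))
    (hpt : ∀ x y t, 0 < t → t < 1 → p (Quot.mk _ (Sum.inr (x, y, t)))) (c) : p c := by
  rcases c with ⟨(x | y) | ⟨x, y, t⟩⟩
  · exact hl x
  · exact hr y
  · rcases eq_or_ne t 0 with rfl | h0
    · exact (Quot.sound (JoinRel.left x y)) ▸ hl x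
    rcases eq_or_ne t 1 with rfl | h1
    · exact (Quot.sound (JoinRel.right x y)) ▸ hr y
    exact hpt x y t (unitInterval.pos_iff_ne_zero.2 h0) (unitInterval.lt_one_iff_ne_one.2 h1)

theorem mass_Ioi_of_mem_Iio {m : P} (a : realization (orderComplex (Set.Iio m))) :
    mass (Set.Ioi m) (a : P → ℝ) = 0 :=
  mass_eq_zero <| (Set.disjoint_left.2 fun _ h h' => lt_asymm (Set.mem_Iio.1 h) h').mono_left
    (mem_realization_orderComplex.1 a.2).2.1

theorem mass_Ioi_of_mem_Ioi {m : P} (b : realization (orderComplex (Set.Ioi m))) :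
    mass (Set.Ioi m) (b : P → ℝ) = 1 :=
  mass_eq_one b.2.1 (mem_realization_orderComplex.1 b.2).2.1

/-- The weight of the vertices above `m` determines the join coordinate. -/
theorem joinToFun_injective (m : P) : Function.Injective (joinToFun m) := by
  have hpt : ∀ a b t, mass (Set.Ioi m) (joinToFun m (Quot.mk _ (Sum.inr (a, b, t)))) = t :=
    fun a b t => by
      refine (mass_add_smul _ _).trans ?_
      rw [mass_Ioi_of_mem_Iio, mass_Ioi_of_mem_Ioi]
      ring
  have hl : ∀ a, mass (Set.Ioi m) (joinToFun m (Quot.mk _ (Sum.inl (Sum.inl a)))) = 0 :=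
    mass_Ioi_of_mem_Iio
  have hr : ∀ b, mass (Set.Ioi m) (joinToFun m (Quot.mk _ (Sum.inl (Sum.inr b)))) = 1 :=
    mass_Ioi_of_mem_Ioi
  intro c d h
  have hm := congrArg (mass (Set.Ioi m)) h
  induction c using Join.cases_interior with
  | hl a =>
    induction d using Join.cases_interior with
    | hl a' => rw [Subtype.ext (show (a : P → ℝ) = a' from h)]
    | hr b' => simp [hl, hr] at hm
    | hpt a' b' t' h0 h1 => rw [hl, hpt] at hm; exact absurd (Subtype.ext hm) h0.ne
  | hr b =>
    induction d using Join.cases_interior with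
    | hl a' => simp [hl, hr] at hm
    | hr b' => rw [Subtype.ext (show (b : P → ℝ) = b' from h)]
    | hpt a' b' t' h0 h1 => rw [hr, hpt] at hm; exact absurd (Subtype.ext hm.symm) h1.ne
  | hpt a b t h0 h1 =>
    induction d using Join.cases_interior with
    | hl a' => rw [hl, hpt] at hm; exact absurd (Subtype.ext hm.symm) h0.ne
    | hr b' => rw [hr, hpt] at hm; exact absurd (Subtype.ext hm) h1.ne
    | hpt a' b' t' _ _ =>
      rw [hpt, hpt] at hm
      obtain rfl : t = t' := Subtype.ext hm
      have ht0 : (t : ℝ) ≠ 0 := fun h => h0.ne' (Subtype.ext h)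
      have ht1 : (1 - (t : ℝ)) ≠ 0 := fun h => h1.ne (Subtype.ext (sub_eq_zero.1 h).symm)
      have hp : ∀ p, (1 - (t : ℝ)) * (a : P → ℝ) p + t * (b : P → ℝ) p =
          (1 - (t : ℝ)) * (a' : P → ℝ) p + t * (b' : P → ℝ) p := congrFun h
      have ha0 : ∀ (a : realization (orderComplex (Set.Iio m))) (p : P), ¬ p < m →
          (a : P → ℝ) p = 0 := fun a p hp =>
        by_contra fun h => hp ((mem_realization_orderComplex.1 a.2).2.1 h)
      have hb0 : ∀ (b : realization (orderComplex (Set.Ioi m))) (p : P), ¬ m < p →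
          (b : P → ℝ) p = 0 := fun b p hp =>
        by_contra fun h => hp ((mem_realization_orderComplex.1 b.2).2.1 h)
      obtain rfl : a = a' := by
        ext p
        by_cases hpm : p < m
        · simpa [hb0 _ p hpm.not_gt, ht1] using hp p
        · rw [ha0 _ p hpm, ha0 _ p hpm]
      obtain rfl : b = b' := by
        ext p
        by_cases hpm : m < p
        · simpa [ha0 _ p hpm.not_gt, ht0] using hp p
        · rw [hb0 _ p hpm, hb0 _ p hpm]
      rfl

theorem joinToFun_mem_realization (m : P) (c) :
    joinToFun m c ∈ realization (orderComplex (strictlyComparable m)) := by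
  have hA : Set.Iio m ⊆ strictlyComparable m := Set.subset_union_left
  have hB : Set.Ioi m ⊆ strictlyComparable m := Set.subset_union_right
  rcases c with ⟨(a | b) | ⟨a, b, t⟩⟩
  · obtain ⟨h1, h2, h3⟩ := mem_realization_orderComplex.1 a.2
    exact mem_realization_orderComplex.2 ⟨h1, h2.trans hA, h3⟩
  · obtain ⟨h1, h2, h3⟩ := mem_realization_orderComplex.1 b.2
    exact mem_realization_orderComplex.2 ⟨h1, h2.trans hB, h3⟩
  · exact combination_mem_realization a.2 b.2 hA hB
      (fun p hp q hq => Or.inl (lt_trans (Set.mem_Iio.1 hp) hq).le) t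

theorem exists_joinToFun_eq {m : P} {z : P → ℝ}
    (hz : z ∈ realization (orderComplex (strictlyComparable m))) : ∃ c, joinToFun m c = z := by
  obtain ⟨hz1, hs, hc⟩ := mem_realization_orderComplex.1 hz
  by_cases hB : mass (Set.Ioi m) z = 0
  · refine ⟨Quot.mk _ (Sum.inl (Sum.inl
      ⟨z, mem_realization_orderComplex.2 ⟨hz1, fun p hp => ?_, hc⟩⟩)), rfl⟩
    exact (hs hp).resolve_right fun h => hp (eq_zero_of_mass_eq_zero hz1 hB h)
  by_cases hA : mass (Set.Iio m) z = 0
  · refine ⟨Quot.mk _ (Sum.inl (Sum.inr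
      ⟨z, mem_realization_orderComplex.2 ⟨hz1, fun p hp => ?_, hc⟩⟩)), rfl⟩
    exact (hs hp).resolve_left fun h => hp (eq_zero_of_mass_eq_zero hz1 hA h)
  have hle : mass (Set.Ioi m) z ≤ 1 := by
    have h1 := mass_add_mass_compl (S := Set.Ioi m) hz1
    have h2 := mass_nonneg (S := (Set.Ioi m)ᶜ) hz1
    linarith
  have hmem : ∀ T, T ⊆ strictlyComparable m → mass T z ≠ 0 →
      normalize T z ∈ realization (orderComplex T) := fun T hT h => by
    have := normalize_mem_realization hz h
    rwa [Set.inter_eq_right.2 hT] at this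
  refine ⟨Quot.mk _ (Sum.inr (⟨_, hmem _ Set.subset_union_left hA⟩,
    ⟨_, hmem _ Set.subset_union_right hB⟩, ⟨_, mass_nonneg hz1, hle⟩)), ?_⟩
  exact eq_smul_normalize_add hz1
    (Set.disjoint_left.2 fun _ h h' => lt_asymm (Set.mem_Iio.1 h) h') hs hA hB

instance {X : Type v} {Y : Type w} [TopologicalSpace X] [TopologicalSpace Y] [CompactSpace X]
    [CompactSpace Y] : CompactSpace (Join X Y) :=
  inferInstanceAs (CompactSpace (Quot (JoinRel X Y)))

end Poset

end PosetTopology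

end

theorem theorem2p2 {P : Type*} [PartialOrder P] [Fintype P] (M : Set P) :
    -- the general case
    (∀ (hM : IsAntichain (· ≤ ·) M) (x : realization (orderComplex Mᶜ)),
      (ContinuousMap.inclusion (realization_mono (linkUnion_le hM))).Homotopic
        (ContinuousMap.const (realization (linkUnion M)) x) →
      Nonempty (realization (orderComplex (Set.univ : Set P)) ≃ₕ
        Wedge x (fun m : M => Suspension.pole
          (Join (realization (orderComplex (Set.Iio (m : P))))
            (realization (orderComplex (Set.Ioi (m : P)))))))) ∧
    -- the case of maximal elements
    (∀ (hM : ∀ m ∈ M, IsMax m) (x : realization (orderComplex Mᶜ)),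
      (ContinuousMap.inclusion (realization_mono (lowerLinkUnion_le hM))).Homotopic
        (ContinuousMap.const (realization (lowerLinkUnion M)) x) →
      Nonempty (realization (orderComplex (Set.univ : Set P)) ≃ₕ
        Wedge x (fun m : M => Suspension.pole
          (realization (orderComplex (Set.Iio (m : P))))))) := by
  refine ⟨fun hM x hx => ?_, fun hM x hx => ?_⟩
  · have hmem : ∀ (m : M) c, joinToFun (m : P) c ∈ realization (linkUnion M) := fun m c => by
      obtain ⟨h1, h2, h3⟩ := mem_realization_orderComplex.1 (joinToFun_mem_realization (m : P) c)
      exact mem_realization_linkUnion m.2 h1 h3 h2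
    refine nonempty_homotopyEquiv_wedge_of_links hM (linkUnion_le hM) x hx
      (fun m => ⟨_, (continuous_joinToFun (m : P)).subtype_mk (hmem m)⟩)
      (fun m c d h => joinToFun_injective _ (congrArg Subtype.val h)) fun m z hz => ⟨?_, fun h => ?_⟩
    · rintro ⟨c, rfl⟩
      exact (mem_realization_orderComplex.1 (joinToFun_mem_realization (m : P) c)).2.1
    · obtain ⟨h1, -, h3⟩ := mem_realization_orderComplex.1 hz
      exact exists_joinToFun_eq (mem_realization_orderComplex.2 ⟨h1, h, h3⟩)
  · have hle : ∀ m : M, orderComplex (Set.Iio (m : P)) ≤ lowerLinkUnion M := fun m =>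
      le_iSup₂_of_le (m : P) m.2 le_rfl
    have hcomp : ∀ m : M, strictlyComparable (m : P) = Set.Iio (m : P) := fun m => by
      rw [strictlyComparable, (hM m m.2).Ioi_eq, Set.union_empty]
    refine nonempty_homotopyEquiv_wedge_of_links
      (fun m hm n _ hmn h => hmn (le_antisymm h (hM m hm h))) (lowerLinkUnion_le hM) x hx
      (fun m => ContinuousMap.inclusion (realization_mono (hle m)))
      (fun m => Set.inclusion_injective (realization_mono (hle m))) fun m z hz => ?_
    rw [hcomp]
    constructor
    · rintro ⟨y, rfl⟩
      exact (mem_realization_orderComplex.1 y.2).2.1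
    · obtain ⟨h1, -, h3⟩ := mem_realization_orderComplex.1 hz
      exact fun h => ⟨⟨z, mem_realization_orderComplex.2 ⟨h1, h, h3⟩⟩, rfl⟩
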